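/- There are $m=3$ objects. A ranking is a permutation $\sigma$ of $\{1,2,3\}$, where $\sigma(i)$ is the rank of object $i$ and $\sigma^{-1}(1)$ is the top ranked object; a relevance vector is $r\in\{0,1\}^3$. Let $$\mathrm{SumLoss}(\sigma,r)=\sum_{i=1}^3\sigma(i)\,r(i),\qquad \mathrm{PairwiseLoss}(\sigma,r)=\sum_{i=1}^3\sum_{j=1}^3 \mathbf 1(\sigma(i)<\sigma(j))\,\mathbf 1(r(i)<r(j)).$$ An oblivious adversary fixes relevance vectors $r_1,\dots,r_T$ in advance. In each round $t=1,\dots,T$ the learner outputs a ranking $\sigma_t$, possibly using internal randomization, based only on the feedback received in earlier rounds, and then observes only the relevance $r_t(\sigma_t^{-1}(1))$ of its top ranked object (top-1 feedback). There is an absolute constant $c>0$ such that for every (possibly randomized) online learning algorithm and every horizon $T\ge 1$ there are relevance vectors $r_1,\dots,r_T\in\{0,1\}^3$ with $$\mathbb E\Big[\sum_{t=1}^T \mathrm{SumLoss}(\sigma_t,r_t)\Big]-\min_{\sigma}\sum_{t=1}^T \mathrm{SumLoss}(\sigma,r_t)\ \ge\ c\,T^{2/3},$$ where the expectation is over the learner's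 randomization; for the same relevance vectors the same inequality also holds with $\mathrm{PairwiseLoss}$ in place of $\mathrm{SumLoss}$. -/

import Mathlib

open MeasureTheory

/-- A ranking of `m` objects, as a map from objects to positions. Objects and positions are numbered
from `0`: object `i` is placed at rank `σ i + 1`, and the top ranked object is `σ.symm 0`. -/
abbrev Ranking (m : ℕ) := Equiv.Perm (Fin m)

/-- A binary relevance vector `r ∈ {0,1}^m`. -/
abbrev Relevance (m : ℕ) := Fin m → Fin 2

/-- `SumLoss(σ, r) = ∑ i, σ(i) r(i)`, with ranks `σ(i) ∈ {1, …, m}`. -/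
noncomputable def sumLoss {m : ℕ} (σ : Ranking m) (r : Relevance m) : ℝ :=
  ∑ i : Fin m, (((σ i : ℕ) : ℝ) + 1) * ((r i : ℕ) : ℝ)

/-- `PairwiseLoss(σ, r) = ∑ i, ∑ j, 1(σ(i) < σ(j)) 1(r(i) < r(j))`. -/
noncomputable def pairwiseLoss {m : ℕ} (σ : Ranking m) (r : Relevance m) : ℝ :=
  ∑ i : Fin m, ∑ j : Fin m, (if σ i < σ j then 1 else 0) * (if r i < r j then 1 else 0)

/-- Top-1 feedback: the relevance of the top ranked object. -/
def topFeedback {m : ℕ} [NeZero m] (σ : Ranking m) (r : Relevance m) : Fin 2 :=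
  r (σ.symm 0)

/-- A randomized online ranking algorithm with top-1 feedback. All of its internal randomization is
a random seed `ω : Ω`; given the seed, the ranking it outputs is a function of the list of feedbacks
of the previous rounds, oldest first (the round number is the length of this list, and the previous
rankings are determined by the seed and the previous feedbacks). -/
structure OnlineAlgorithm (m : ℕ) (Ω : Type*) [MeasurableSpace Ω] where
  act : Ω → List (Fin 2) → Ranking m
  measurableSet_act : ∀ (h : List (Fin 2)) (σ : Ranking m), MeasurableSet {ω | act ω h = σ}

namespace OnlineAlgorithm

variable {m : ℕ} [NeZero m] {Ω : Type*} [MeasurableSpace Ω]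

/-- The feedbacks received in the first `t` rounds (rounds `0, …, t - 1`) against the relevance
vectors `r 0, r 1, …`, when the seed is `ω`. -/
def history (A : OnlineAlgorithm m Ω) (r : ℕ → Relevance m) (ω : Ω) : ℕ → List (Fin 2)
  | 0 => []
  | t + 1 => A.history r ω t ++ [topFeedback (A.act ω (A.history r ω t)) (r t)]

/-- The ranking `σ_t` output in round `t`. -/
def ranking (A : OnlineAlgorithm m Ω) (r : ℕ → Relevance m) (ω : Ω) (t : ℕ) : Ranking m :=
  A.act ω (A.history r ω t)

/-- The expected regret over the rounds `0, …, T - 1`: the expected total loss, with the seed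
distributed according to `μ`, minus the total loss of the best fixed ranking in hindsight. -/
noncomputable def regret (A : OnlineAlgorithm m Ω) (loss : Ranking m → Relevance m → ℝ)
    (μ : Measure Ω) (r : ℕ → Relevance m) (T : ℕ) : ℝ :=
  (∫ ω, ∑ t ∈ Finset.range T, loss (A.ranking r ω t) (r t) ∂μ) -
    Finset.univ.inf' Finset.univ_nonempty
      (fun σ : Ranking m => ∑ t ∈ Finset.range T, loss σ (r t))

theorem measurableSet_history (A : OnlineAlgorithm m Ω) (r : ℕ → Relevance m) (t : ℕ) :
    ∀ h : List (Fin 2), MeasurableSet {ω | A.history r ω t = h} := by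
  induction t with
  | zero => intro h; simp [history]
  | succ t ih =>
    intro h
    have e : {ω | A.history r ω (t + 1) = h} = ⋃ (h' : List (Fin 2)) (σ : Ranking m)
        (_ : h' ++ [topFeedback σ (r t)] = h), {ω | A.history r ω t = h'} ∩ {ω | A.act ω h' = σ} := by
      ext ω
      simp only [history, Set.mem_ofPred_eq, Set.mem_iUnion, Set.mem_inter_iff, exists_prop]
      constructor
      · intro hh
        exact ⟨_, _, hh, rfl, rfl⟩
      · rintro ⟨h', σ, hh, rfl, rfl⟩
        exact hh
    rw [e]
    exact MeasurableSet.iUnion fun h' => MeasurableSet.iUnion fun σ => MeasurableSet.iUnion fun _ =>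
      (ih h').inter (A.measurableSet_act h' σ)

theorem measurableSet_ranking (A : OnlineAlgorithm m Ω) (r : ℕ → Relevance m) (t : ℕ)
    (σ : Ranking m) : MeasurableSet {ω | A.ranking r ω t = σ} := by
  have e : {ω | A.ranking r ω t = σ} = ⋃ h : List (Fin 2),
      {ω | A.history r ω t = h} ∩ {ω | A.act ω h = σ} := by
    ext ω
    simp [ranking]
  rw [e]
  exact MeasurableSet.iUnion fun h =>
    (A.measurableSet_history r t h).inter (A.measurableSet_act h σ)

/-- The total loss is integrable, so the integral in `regret` is a genuine expectation. -/
theorem integrable_loss (A : OnlineAlgorithm m Ω) (loss : Ranking m → Relevance m → ℝ)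
    (μ : Measure Ω) [IsProbabilityMeasure μ] (r : ℕ → Relevance m) (T : ℕ) :
    Integrable (fun ω => ∑ t ∈ Finset.range T, loss (A.ranking r ω t) (r t)) μ := by
  refine integrable_finsetSum _ fun t _ => ?_
  have e : (fun ω => loss (A.ranking r ω t) (r t)) = fun ω => ∑ σ : Ranking m,
      Set.indicator {ω | A.ranking r ω t = σ} (fun _ => loss σ (r t)) ω := by
    ext ω
    simp [Set.indicator_apply]
  rw [e]
  exact integrable_finsetSum _ fun σ _ =>
    (integrable_const _).indicator (A.measurableSet_ranking r t σ)

end OnlineAlgorithm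

/-!
The adversary draws the relevance vectors independently from one of two distributions: object `0` is
always relevant, and exactly one of the objects `1` and `2` is, the first with probability
`1 / 2 + ε` or `1 / 2 - ε`. Ranking object `0` at the top is necessary for a small loss, but its
relevance is known in advance, so the feedback tells nothing; ranking another object at the top is
informative but costs a constant. With two hypotheses of weights `u` and `v`, an uninformative round
costs at least `2 ε · u v / (u + v)`, and this potential shrinks in an informative round by at most
the factor `1 - 4 ε ^ 2`, the squared Bhattacharyya coefficient. As long as `T ε ^ 3` is bounded,
the constant price of an informative round outweighs the `O(T ε ^ 3)` it can save in later
rounds, so the regret is of order `T ε`, and `ε ∼ T ^ (-1 / 3)` is the optimal choice.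

The regrets for the two losses coincide: a vector with `k` relevant objects has
`sumLoss = pairwiseLoss + k (k + 1) / 2` for every ranking.
-/

/-- The parallel sum of two weights, half their harmonic mean. It serves as a potential measuring
how undecided a learner still is between two hypotheses of weights `u` and `v`. -/
noncomputable def parallelSum (u v : ℝ) : ℝ := u * v / (u + v)

section ParallelSum

variable {u v : ℝ}

theorem parallelSum_nonneg (hu : 0 ≤ u) (hv : 0 ≤ v) : 0 ≤ parallelSum u v := by
  unfold parallelSum
  positivity

theorem parallelSum_comm (u v : ℝ) : parallelSum u v = parallelSum v u := by
  rw [parallelSum, parallelSum, mul_comm, add_comm]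

theorem parallelSum_le_left (hu : 0 ≤ u) (hv : 0 ≤ v) : parallelSum u v ≤ u :=
  div_le_of_le_mul₀ (by positivity) hu (by nlinarith)

theorem parallelSum_le_right (hu : 0 ≤ u) (hv : 0 ≤ v) : parallelSum u v ≤ v :=
  parallelSum_comm u v ▸ parallelSum_le_left hv hu

theorem four_mul_parallelSum_le_add (hu : 0 ≤ u) (hv : 0 ≤ v) : 4 * parallelSum u v ≤ u + v := by
  rw [parallelSum, ← mul_div_assoc]
  exact div_le_of_le_mul₀ (by positivity) (by positivity) (by nlinarith [sq_nonneg (u - v)])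

theorem parallelSum_mul_add (hu : 0 ≤ u) (hv : 0 ≤ v) : parallelSum u v * (u + v) = u * v := by
  rcases (add_nonneg hu hv).eq_or_lt with h | h
  · obtain rfl : u = 0 := by linarith
    simp [parallelSum]
  · exact div_mul_cancel₀ _ h.ne'

theorem add_mul_parallelSum_le {p q : ℝ} (hu : 0 ≤ u) (hv : 0 ≤ v) (hp : 0 ≤ p) (hq : 0 ≤ q) :
    (p + q) * parallelSum u v ≤ u * p + v * q :=
  calc (p + q) * parallelSum u v = parallelSum u v * p + parallelSum u v * q := by ring
    _ ≤ u * p + v * q := by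
        gcongr
        exacts [parallelSum_le_left hu hv, parallelSum_le_right hu hv]

theorem four_mul_mul_parallelSum_le {κ p q : ℝ} (hu : 0 ≤ u) (hv : 0 ≤ v) (hκ : 0 ≤ κ)
    (hp : κ ≤ p) (hq : κ ≤ q) : 4 * κ * parallelSum u v ≤ u * p + v * q :=
  calc 4 * κ * parallelSum u v = κ * (4 * parallelSum u v) := by ring
    _ ≤ κ * (u + v) := by gcongr; exact four_mul_parallelSum_le_add hu hv
    _ = u * κ + v * κ := by ring
    _ ≤ u * p + v * q := by gcongr

end ParallelSum

section Bhattacharyya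

variable {X : Type*} [Fintype X] {P Q : X → ℝ} {u v : ℝ}

/-- The Bhattacharyya coefficient of two distributions on a finite type: `1` when they agree, and
`0` when a single observation tells them apart. -/
noncomputable def bhattacharyya (P Q : X → ℝ) : ℝ := ∑ x, √(P x * Q x)

theorem bhattacharyya_sq_le_one (hP : P ∈ stdSimplex ℝ X) (hQ : Q ∈ stdSimplex ℝ X) :
    bhattacharyya P Q ^ 2 ≤ 1 := by
  have cauchy_schwarz := Finset.univ.sum_sq_le_sum_mul_sum_of_sq_le_mul
    (fun x _ => hP.1 x) (fun x _ => hQ.1 x)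
    (fun x _ => (Real.sq_sqrt (mul_nonneg (hP.1 x) (hQ.1 x))).le)
  rwa [hP.2, hQ.2, mul_one] at cauchy_schwarz

/-- Cauchy–Schwarz applied to the products `parallelSum (u P) (v Q) * (u P + v Q) = u v P Q`. -/
theorem bhattacharyya_sq_mul_parallelSum_le (hP : P ∈ stdSimplex ℝ X) (hQ : Q ∈ stdSimplex ℝ X)
    (hu : 0 ≤ u) (hv : 0 ≤ v) :
    bhattacharyya P Q ^ 2 * parallelSum u v ≤ ∑ x, parallelSum (u * P x) (v * Q x) := by
  have huP (x : X) : 0 ≤ u * P x := mul_nonneg hu (hP.1 x)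
  have hvQ (x : X) : 0 ≤ v * Q x := mul_nonneg hv (hQ.1 x)
  have cauchy_schwarz : (∑ x, √(u * v) * √(P x * Q x)) ^ 2 ≤
      (∑ x, parallelSum (u * P x) (v * Q x)) * ∑ x, (u * P x + v * Q x) := by
    refine Finset.univ.sum_sq_le_sum_mul_sum_of_sq_le_mul
      (fun x _ => parallelSum_nonneg (huP x) (hvQ x)) (fun x _ => add_nonneg (huP x) (hvQ x))
      fun x _ => ?_
    rw [parallelSum_mul_add (huP x) (hvQ x), mul_pow, Real.sq_sqrt (mul_nonneg hu hv),
      Real.sq_sqrt (mul_nonneg (hP.1 x) (hQ.1 x)), mul_mul_mul_comm]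
  rw [← Finset.mul_sum, mul_pow, Real.sq_sqrt (mul_nonneg hu hv), Finset.sum_add_distrib,
    ← Finset.mul_sum, ← Finset.mul_sum, hP.2, hQ.2, mul_one, mul_one, mul_comm] at cauchy_schwarz
  rw [parallelSum, ← mul_div_assoc]
  exact div_le_of_le_mul₀ (add_nonneg hu hv)
    (Finset.sum_nonneg fun x _ => parallelSum_nonneg (huP x) (hvQ x)) cauchy_schwarz

end Bhattacharyya

section IidMean

variable {X : Type*} [Fintype X] {P : X → ℝ}

/-- The expectation of `F` over lists of `n` independent outcomes with distribution `P`. -/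
noncomputable def iidMean (P : X → ℝ) : ℕ → (List X → ℝ) → ℝ
  | 0, F => F []
  | n + 1, F => ∑ x, P x * iidMean P n fun l => F (x :: l)

theorem iidMean_const_add (hP : P ∈ stdSimplex ℝ X) (n : ℕ) (a : ℝ) (F : List X → ℝ) :
    iidMean P n (fun l => a + F l) = a + iidMean P n F := by
  induction n generalizing F with
  | zero => rfl
  | succ n ih =>
    simp only [iidMean, ih, mul_add, Finset.sum_add_distrib, ← Finset.sum_mul, hP.2, one_mul]

theorem exists_iidMean_le (hP : P ∈ stdSimplex ℝ X) (n : ℕ) (F : List X → ℝ) :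
    ∃ l : List X, l.length = n ∧ iidMean P n F ≤ F l := by
  induction n generalizing F with
  | zero => exact ⟨[], rfl, le_rfl⟩
  | succ n ih =>
    choose l hl hF using fun x => ih fun l => F (x :: l)
    have hX : Nonempty X := by
      by_contra! h
      simp [stdSimplex_of_isEmpty_index] at hP
    obtain ⟨y, hy⟩ := Finite.exists_max fun x => F (x :: l x)
    refine ⟨y :: l y, by simp [hl], ?_⟩
    calc iidMean P (n + 1) F
        ≤ ∑ x, P x * F (y :: l y) :=
          Finset.sum_le_sum fun x _ => mul_le_mul_of_nonneg_left ((hF x).trans (hy x)) (hP.1 x)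
      _ = F (y :: l y) := by rw [← Finset.sum_mul, hP.2, one_mul]

variable {Ω : Type*} [MeasurableSpace Ω] {μ : Measure Ω} {F : Ω → List X → ℝ}

theorem integrable_iidMean (n : ℕ) (hF : ∀ l, Integrable (fun ω => F ω l) μ) :
    Integrable (fun ω => iidMean P n (F ω)) μ := by
  induction n generalizing F with
  | zero => exact hF []
  | succ n ih => exact integrable_finsetSum _ fun x _ => (ih fun l => hF (x :: l)).const_mul (P x)

theorem integral_iidMean (n : ℕ) (hF : ∀ l, Integrable (fun ω => F ω l) μ) :
    ∫ ω, iidMean P n (F ω) ∂μ = iidMean P n fun l => ∫ ω, F ω l ∂μ := by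
  induction n generalizing F with
  | zero => rfl
  | succ n ih =>
    simp only [iidMean]
    rw [integral_finsetSum _ fun x _ =>
      (integrable_iidMean n fun l => hF (x :: l)).const_mul (P x)]
    exact Finset.sum_congr rfl fun x _ => by rw [integral_const_mul, ih fun l => hF (x :: l)]

end IidMean

section TwoPoint

variable {α β X : Type*}

/-- The total loss of the deterministic strategy `act` against a list of outcomes, when it has
already received the feedbacks `h`. -/
def strategyLoss (loss : α → X → ℝ) (feedback : α → X → β) (act : List β → α) :
    List β → List X → ℝ
  | _, [] => 0
  | h, x :: l => loss (act h) x + strategyLoss loss feedback act (h ++ [feedback (act h) x]) l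

variable [Fintype X] {f g : α → X → ℝ} {feedback : α → X → β} {P Q : X → ℝ} {γ κ : ℝ}

theorem iidMean_succ_strategyLoss (hP : P ∈ stdSimplex ℝ X) (n : ℕ) (act : List β → α)
    (h : List β) :
    iidMean P (n + 1) (strategyLoss f feedback act h) = P ⬝ᵥ f (act h) +
      ∑ x, P x * iidMean P n (strategyLoss f feedback act (h ++ [feedback (act h) x])) := by
  simp only [iidMean, strategyLoss, iidMean_const_add hP, mul_add, Finset.sum_add_distrib,
    dotProduct]

/-- A partial-monitoring game with two confusable outcome distributions `P` and `Q`. The losses `f`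
under `P` and `g` under `Q` are meant to be measured relative to the best action for `P`, resp. `Q`.
An action either reveals nothing about the outcome, and then costs `γ` in total over the two
distributions, or costs `κ` under each of them. -/
structure IsConfusingGame (f g : α → X → ℝ) (feedback : α → X → β) (P Q : X → ℝ) (γ κ : ℝ) :
    Prop where
  left_mem : P ∈ stdSimplex ℝ X
  right_mem : Q ∈ stdSimplex ℝ X
  left_nonneg : ∀ a, 0 ≤ P ⬝ᵥ f a
  right_nonneg : ∀ a, 0 ≤ Q ⬝ᵥ g a
  blind_or_costly : ∀ a, ((∃ y, ∀ x, feedback a x = y) ∧ γ ≤ P ⬝ᵥ f a + Q ⬝ᵥ g a) ∨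
    (κ ≤ P ⬝ᵥ f a ∧ κ ≤ Q ⬝ᵥ g a)

/-- The potential survives a blind action unchanged and shrinks by at most the factor
`bhattacharyya P Q ^ 2` after a costly one, whose price covers the shrinkage of all later rounds. -/
theorem IsConfusingGame.mul_parallelSum_le (G : IsConfusingGame f g feedback P Q γ κ) (hγ : 0 ≤ γ)
    {n : ℕ} (hn : γ * (1 + n * (1 - bhattacharyya P Q ^ 2)) ≤ 4 * κ) (act : List β → α)
    (h : List β) {u v : ℝ} (hu : 0 ≤ u) (hv : 0 ≤ v) :
    n * γ * parallelSum u v ≤ u * iidMean P n (strategyLoss f feedback act h) +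
      v * iidMean Q n (strategyLoss g feedback act h) := by
  induction n generalizing h u v with
  | zero => simp [iidMean, strategyLoss]
  | succ n ih =>
    have hδ : 0 ≤ 1 - bhattacharyya P Q ^ 2 :=
      sub_nonneg.2 (bhattacharyya_sq_le_one G.left_mem G.right_mem)
    push_cast at hn ⊢
    have hn' : γ * (1 + n * (1 - bhattacharyya P Q ^ 2)) ≤ 4 * κ :=
      hn.trans' (by gcongr; linarith)
    rw [iidMean_succ_strategyLoss G.left_mem, iidMean_succ_strategyLoss G.right_mem]
    rcases G.blind_or_costly (act h) with ⟨⟨y, hy⟩, hcost⟩ | ⟨hcostP, hcostQ⟩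
    · have now := (mul_le_mul_of_nonneg_right hcost (parallelSum_nonneg hu hv)).trans
        (add_mul_parallelSum_le hu hv (G.left_nonneg (act h)) (G.right_nonneg (act h)))
      have later := ih hn' (h ++ [y]) hu hv
      simp only [hy, ← Finset.sum_mul, G.left_mem.2, G.right_mem.2, one_mul]
      linarith
    · have hκ : 0 ≤ 4 * κ := hn'.trans' (by positivity)
      have now := (mul_le_mul_of_nonneg_right hn' (parallelSum_nonneg hu hv)).trans
        (four_mul_mul_parallelSum_le hu hv (by linarith) hcostP hcostQ)
      have later := Finset.sum_le_sum fun x (_ : x ∈ Finset.univ) =>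
        ih hn' (h ++ [feedback (act h) x]) (mul_nonneg hu (G.left_mem.1 x))
          (mul_nonneg hv (G.right_mem.1 x))
      simp only [← Finset.mul_sum, Finset.sum_add_distrib, mul_assoc] at later
      have shrink := mul_le_mul_of_nonneg_left
        (bhattacharyya_sq_mul_parallelSum_le G.left_mem G.right_mem hu hv)
        (mul_nonneg n.cast_nonneg hγ)
      linarith

end TwoPoint

section PairwiseLoss

variable {m : ℕ}

theorem sum_ite_lt_apply (σ : Ranking m) (j : Fin m) :
    ∑ i, (if σ i < σ j then (1 : ℝ) else 0) = (σ j : ℕ) := by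
  rw [Equiv.sum_comp σ fun k => if k < σ j then (1 : ℝ) else 0, Finset.sum_boole,
    Finset.filter_gt_eq_Iio, Fin.card_Iio]

theorem ite_fin_two_lt_eq_one_sub_mul (a b : Fin 2) :
    (if a < b then (1 : ℝ) else 0) = (1 - (a : ℕ)) * (b : ℕ) := by
  fin_cases a <;> fin_cases b <;> simp

theorem fin_two_cast_sq (a : Fin 2) : ((a : ℕ) : ℝ) ^ 2 = (a : ℕ) := by
  fin_cases a <;> simp

theorem two_mul_sum_ite_lt_mul {ι κ : Type*} [Fintype ι] [LinearOrder κ] {σ : ι → κ}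
    (hσ : Function.Injective σ) (a : ι → ℝ) :
    2 * ∑ j, ∑ i, (if σ i < σ j then (1 : ℝ) else 0) * (a i * a j) =
      (∑ i, a i) ^ 2 - ∑ i, a i ^ 2 := by
  classical
  have transpose : ∑ j, ∑ i, (if σ i < σ j then (1 : ℝ) else 0) * (a i * a j) =
      ∑ j, ∑ i, (if σ j < σ i then (1 : ℝ) else 0) * (a i * a j) := by
    rw [Finset.sum_comm]
    simp only [mul_comm]
  have trichotomy (i j : ι) :
      (if σ i < σ j then (1 : ℝ) else 0) * (a i * a j) +
        (if σ j < σ i then (1 : ℝ) else 0) * (a i * a j) =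
      a i * a j - if i = j then a j ^ 2 else 0 := by
    rcases lt_trichotomy (σ i) (σ j) with h | h | h
    · simp [h, h.not_gt, ne_of_apply_ne σ h.ne]
    · simp [hσ h, sq]
    · simp [h, h.not_gt, ne_of_apply_ne σ h.ne']
  rw [two_mul]
  nth_rewrite 2 [transpose]
  simp only [← Finset.sum_add_distrib, trichotomy, Finset.sum_sub_distrib, Finset.sum_ite_eq',
    Finset.mem_univ, if_true, ← Finset.sum_mul, ← Finset.mul_sum, sq]

theorem sumLoss_eq_pairwiseLoss_add (σ : Ranking m) (r : Relevance m) :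
    sumLoss σ r =
      pairwiseLoss σ r + ((∑ i, ((r i : ℕ) : ℝ)) ^ 2 + ∑ i, ((r i : ℕ) : ℝ)) / 2 := by
  have hpairwise : pairwiseLoss σ r = ∑ j, ((σ j : ℕ) : ℝ) * (r j : ℕ) -
      ∑ j, ∑ i, (if σ i < σ j then (1 : ℝ) else 0) * ((r i : ℕ) * (r j : ℕ)) := by
    rw [pairwiseLoss, Finset.sum_comm]
    simp only [ite_fin_two_lt_eq_one_sub_mul (r _), ← sum_ite_lt_apply, Finset.sum_mul,
      ← Finset.sum_sub_distrib]
    exact Finset.sum_congr rfl fun j _ => Finset.sum_congr rfl fun i _ => by ring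
  have hrelevant := two_mul_sum_ite_lt_mul σ.injective fun i => ((r i : ℕ) : ℝ)
  simp only [fin_two_cast_sq] at hrelevant
  simp only [sumLoss, add_mul, one_mul, Finset.sum_add_distrib]
  linarith

end PairwiseLoss

section Environment

variable {m : ℕ} {X : Type*}

/-- The loss of a ranking relative to the benchmark `τ`, in a game where the outcome `x` stands for
the relevance vector `env x`. -/
def excessLoss (loss : Ranking m → Relevance m → ℝ) (env : X → Relevance m) (τ σ : Ranking m)
    (x : X) : ℝ :=
  loss σ (env x) - loss τ (env x)

theorem dotProduct_excessLoss [Fintype X] (P : X → ℝ)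
    (loss : Ranking m → Relevance m → ℝ) (env : X → Relevance m) (τ σ : Ranking m) :
    P ⬝ᵥ excessLoss loss env τ σ = P ⬝ᵥ (fun x => loss σ (env x)) - P ⬝ᵥ fun x => loss τ (env x) :=
  dotProduct_sub P (fun x => loss σ (env x)) fun x => loss τ (env x)

/-- The top-1 feedback in a game where the outcome `x` stands for the relevance vector `env x`. -/
def outcomeFeedback [NeZero m] (env : X → Relevance m) (σ : Ranking m) (x : X) : Fin 2 :=
  topFeedback σ (env x)

/-- The oblivious adversary that plays the relevance vectors of a list of outcomes, and `0` once the
list is exhausted. -/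
def listRelevance (env : X → Relevance m) (l : List X) (t : ℕ) : Relevance m :=
  (l.map env).getD t 0

end Environment

namespace OnlineAlgorithm

variable {m : ℕ} [NeZero m] {Ω : Type*} [MeasurableSpace Ω] {μ : Measure Ω}
  {loss loss' : Ranking m → Relevance m → ℝ}

section Regret

variable [IsProbabilityMeasure μ]

theorem regret_eq_of_eq_add {k : Relevance m → ℝ} (hk : ∀ σ s, loss' σ s = loss σ s + k s)
    (A : OnlineAlgorithm m Ω) (r : ℕ → Relevance m) (T : ℕ) :
    A.regret loss' μ r T = A.regret loss μ r T := by
  have inf_add (c : ℝ) (F : Ranking m → ℝ) :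
      Finset.univ.inf' Finset.univ_nonempty (fun σ => F σ + c) =
        Finset.univ.inf' Finset.univ_nonempty F + c :=
    (map_finset_inf' (OrderIso.addRight c) Finset.univ_nonempty F).symm
  unfold regret
  simp only [hk, Finset.sum_add_distrib, inf_add]
  rw [integral_add (A.integrable_loss loss μ r T) (integrable_const _), integral_const,
    probReal_univ, one_smul, add_sub_add_right_eq_sub]

theorem regret_sumLoss_eq_regret_pairwiseLoss (A : OnlineAlgorithm m Ω) (r : ℕ → Relevance m)
    (T : ℕ) : A.regret sumLoss μ r T = A.regret pairwiseLoss μ r T :=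
  regret_eq_of_eq_add sumLoss_eq_pairwiseLoss_add A r T

theorem integral_excess_le_regret (A : OnlineAlgorithm m Ω) (r : ℕ → Relevance m) (T : ℕ)
    (τ : Ranking m) :
    ∫ ω, ∑ t ∈ Finset.range T, (loss (A.ranking r ω t) (r t) - loss τ (r t)) ∂μ ≤
      A.regret loss μ r T := by
  rw [← regret_eq_of_eq_add (loss' := fun σ s => loss σ s - loss τ s)
    (fun σ s => sub_eq_add_neg _ _), regret, le_sub_self_iff]
  exact (Finset.inf'_le _ (Finset.mem_univ τ)).trans_eq (by simp)

end Regret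

section Environment

variable {X : Type*}

theorem sum_ranking_eq_strategyLoss (A : OnlineAlgorithm m Ω)
    (loss : Ranking m → Relevance m → ℝ) (r : ℕ → Relevance m) (ω : Ω)
    (env : X → Relevance m) (l : List X) (t : ℕ)
    (hr : ∀ (i : ℕ) (hi : i < l.length), r (t + i) = env l[i]) :
    ∑ i ∈ Finset.range l.length, loss (A.ranking r ω (t + i)) (r (t + i)) =
      strategyLoss (fun σ x => loss σ (env x)) (outcomeFeedback env) (A.act ω)
        (A.history r ω t) l := by
  induction l generalizing t with
  | nil => rfl
  | cons x l ih =>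
    have hx : r t = env x := hr 0 (by simp)
    have tail := ih (t + 1) fun i hi => by
      rw [add_assoc, add_comm 1 i]
      exact hr (i + 1) (by simpa using hi)
    rw [List.length_cons, Finset.sum_range_succ', add_zero, add_comm, strategyLoss]
    rw [outcomeFeedback, ← hx, ← history, ← tail, ranking]
    simp only [add_assoc, add_comm 1]

theorem sum_excess_listRelevance (A : OnlineAlgorithm m Ω) (loss : Ranking m → Relevance m → ℝ)
    (env : X → Relevance m) (τ : Ranking m) (l : List X) (ω : Ω) :
    ∑ t ∈ Finset.range l.length, (loss (A.ranking (listRelevance env l) ω t)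
        (listRelevance env l t) - loss τ (listRelevance env l t)) =
      strategyLoss (excessLoss loss env τ) (outcomeFeedback env) (A.act ω) [] l := by
  have total := A.sum_ranking_eq_strategyLoss (fun σ s => loss σ s - loss τ s)
    (listRelevance env l) ω env l 0 fun i hi => by simp [listRelevance, hi]
  simp only [zero_add, history] at total
  exact total

variable [IsProbabilityMeasure μ]

theorem integrable_strategyLoss (A : OnlineAlgorithm m Ω) (loss : Ranking m → Relevance m → ℝ)
    (env : X → Relevance m) (τ : Ranking m) (l : List X) :
    Integrable (fun ω =>
      strategyLoss (excessLoss loss env τ) (outcomeFeedback env) (A.act ω) [] l) μ := by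
  simpa only [sum_excess_listRelevance] using
    A.integrable_loss (fun σ s => loss σ s - loss τ s) μ (listRelevance env l) l.length

theorem integral_strategyLoss_le_regret (A : OnlineAlgorithm m Ω)
    (loss : Ranking m → Relevance m → ℝ) (env : X → Relevance m) (τ : Ranking m) (l : List X) :
    ∫ ω, strategyLoss (excessLoss loss env τ) (outcomeFeedback env) (A.act ω) [] l ∂μ ≤
      A.regret loss μ (listRelevance env l) l.length := by
  simpa only [sum_excess_listRelevance] using
    A.integral_excess_le_regret (listRelevance env l) l.length τ

variable [Fintype X] {P Q : X → ℝ} {γ κ : ℝ} {env : X → Relevance m} {τ τ' : Ranking m}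

theorem exists_integral_iidMean_le_regret (hP : P ∈ stdSimplex ℝ X) (A : OnlineAlgorithm m Ω)
    (loss : Ranking m → Relevance m → ℝ) (env : X → Relevance m) (τ : Ranking m) (T : ℕ) :
    ∃ r : ℕ → Relevance m, ∫ ω, iidMean P T
      (strategyLoss (excessLoss loss env τ) (outcomeFeedback env) (A.act ω) []) ∂μ ≤
        A.regret loss μ r T := by
  rw [integral_iidMean T (A.integrable_strategyLoss loss env τ)]
  obtain ⟨l, rfl, hl⟩ := exists_iidMean_le hP T fun l =>
    ∫ ω, strategyLoss (excessLoss loss env τ) (outcomeFeedback env) (A.act ω) [] l ∂μ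
  exact ⟨listRelevance env l, hl.trans (A.integral_strategyLoss_le_regret loss env τ l)⟩

theorem exists_le_regret_of_isConfusingGame
    (G : IsConfusingGame (excessLoss loss env τ) (excessLoss loss env τ') (outcomeFeedback env)
      P Q γ κ)
    (hγ : 0 ≤ γ) {T : ℕ} (hT : γ * (1 + T * (1 - bhattacharyya P Q ^ 2)) ≤ 4 * κ)
    (A : OnlineAlgorithm m Ω) :
    ∃ r : ℕ → Relevance m, T * γ / 4 ≤ A.regret loss μ r T := by
  have hP := integrable_iidMean (P := P) T (A.integrable_strategyLoss (μ := μ) loss env τ)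
  have hQ := integrable_iidMean (P := Q) T (A.integrable_strategyLoss (μ := μ) loss env τ')
  have averaged := integral_mono (integrable_const _) (hP.add hQ) fun ω => by
    simpa only [one_mul, Pi.add_apply] using
      G.mul_parallelSum_le hγ hT (A.act ω) [] zero_le_one zero_le_one
  rw [integral_const, probReal_univ, one_smul, integral_add' hP hQ, parallelSum] at averaged
  obtain ⟨r, hr⟩ := A.exists_integral_iidMean_le_regret (μ := μ) G.left_mem loss env τ T
  obtain ⟨r', hr'⟩ := A.exists_integral_iidMean_le_regret (μ := μ) G.right_mem loss env τ' T
  rcases le_total (A.regret loss μ r T) (A.regret loss μ r' T) with h | h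
  · exact ⟨r', by linarith⟩
  · exact ⟨r, by linarith⟩

end Environment

end OnlineAlgorithm

section TopFeedbackGame

/-- The two relevance vectors between which the adversary mixes: object `0` is always relevant, and
exactly one of the objects `1` and `2` is. -/
def confusingRelevance : Fin 2 → Relevance 3 := ![![1, 1, 0], ![1, 0, 1]]

/-- The distribution on two outcomes that gives the outcome `0` probability `1 / 2 + ε`. -/
noncomputable def biasedCoin (ε : ℝ) : Fin 2 → ℝ := ![1 / 2 + ε, 1 / 2 - ε]

theorem biasedCoin_mem_stdSimplex {ε : ℝ} (hε : |ε| ≤ 1 / 2) :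
    biasedCoin ε ∈ stdSimplex ℝ (Fin 2) := by
  obtain ⟨h, h'⟩ := abs_le.1 hε
  refine ⟨Fin.forall_fin_two.2 ⟨?_, ?_⟩, ?_⟩
  · change 0 ≤ 1 / 2 + ε
    linarith
  · change 0 ≤ 1 / 2 - ε
    linarith
  · simp only [biasedCoin, Fin.sum_univ_two, Matrix.cons_val_zero, Matrix.cons_val_one]
    ring

theorem bhattacharyya_biasedCoin_neg_sq {ε : ℝ} (hε : |ε| ≤ 1 / 2) :
    bhattacharyya (biasedCoin ε) (biasedCoin (-ε)) ^ 2 = 1 - 4 * ε ^ 2 := by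
  have hε2 : ε ^ 2 ≤ (1 / 2) ^ 2 := sq_le_sq' (abs_le.1 hε).1 (abs_le.1 hε).2
  have hprod : (1 / 2 - ε) * (1 / 2 + ε) = 1 / 4 - ε ^ 2 := by ring
  have hprod' : (1 / 2 + ε) * (1 / 2 - ε) = 1 / 4 - ε ^ 2 := by ring
  simp only [bhattacharyya, biasedCoin, Fin.sum_univ_two, Matrix.cons_val_zero,
    Matrix.cons_val_one, sub_neg_eq_add, ← sub_eq_add_neg, hprod, hprod', ← two_mul, mul_pow]
  rw [Real.sq_sqrt (by linarith)]
  ring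

theorem sum_ranks_three : ∀ σ : Ranking 3, (σ 0 : ℕ) + σ 1 + σ 2 = 3 := by
  decide

theorem rank_le_rank_add : ∀ σ : Ranking 3,
    (σ 2 : ℕ) ≤ σ 1 + 1 + σ 0 ∧ (σ 1 : ℕ) ≤ σ 2 + 1 + σ 0 := by
  decide

theorem sumLoss_confusingRelevance_zero (σ : Ranking 3) :
    sumLoss σ (confusingRelevance 0) = 5 - (σ 2 : ℕ) := by
  have hσ : ((σ 0 : ℕ) : ℝ) + (σ 1 : ℕ) + (σ 2 : ℕ) = 3 := mod_cast sum_ranks_three σ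
  have expand : sumLoss σ (confusingRelevance 0) =
      ((σ 0 : ℕ) + 1) + ((σ 1 : ℕ) + 1) := by
    simp [sumLoss, confusingRelevance, Fin.sum_univ_three]
  linarith

theorem sumLoss_confusingRelevance_one (σ : Ranking 3) :
    sumLoss σ (confusingRelevance 1) = 5 - (σ 1 : ℕ) := by
  have hσ : ((σ 0 : ℕ) : ℝ) + (σ 1 : ℕ) + (σ 2 : ℕ) = 3 := mod_cast sum_ranks_three σ
  have expand : sumLoss σ (confusingRelevance 1) =
      ((σ 0 : ℕ) + 1) + ((σ 2 : ℕ) + 1) := by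
    simp [sumLoss, confusingRelevance, Fin.sum_univ_three]
  linarith

theorem biasedCoin_dotProduct_sumLoss (ε : ℝ) (σ : Ranking 3) :
    biasedCoin ε ⬝ᵥ (fun x => sumLoss σ (confusingRelevance x)) =
      7 / 2 + (σ 0 : ℕ) / 2 - ε * ((σ 2 : ℕ) - (σ 1 : ℕ)) := by
  have hσ : ((σ 0 : ℕ) : ℝ) + (σ 1 : ℕ) + (σ 2 : ℕ) = 3 := mod_cast sum_ranks_three σ
  simp only [dotProduct, Fin.sum_univ_two, sumLoss_confusingRelevance_zero,
    sumLoss_confusingRelevance_one, biasedCoin, Matrix.cons_val_zero, Matrix.cons_val_one]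
  linear_combination (-1 / 2) * hσ

theorem biasedCoin_dotProduct_excessLoss_one (ε : ℝ) (σ : Ranking 3) :
    biasedCoin ε ⬝ᵥ excessLoss sumLoss confusingRelevance 1 σ =
      (σ 0 : ℕ) / 2 + ε * (1 - ((σ 2 : ℕ) - (σ 1 : ℕ))) := by
  have benchmark : biasedCoin ε ⬝ᵥ (fun x => sumLoss 1 (confusingRelevance x)) = 7 / 2 - ε := by
    rw [biasedCoin_dotProduct_sumLoss]
    norm_num
  rw [dotProduct_excessLoss, benchmark, biasedCoin_dotProduct_sumLoss]
  ring

theorem biasedCoin_dotProduct_excessLoss_swap (ε : ℝ) (σ : Ranking 3) :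
    biasedCoin (-ε) ⬝ᵥ excessLoss sumLoss confusingRelevance (Equiv.swap 1 2) σ =
      (σ 0 : ℕ) / 2 + ε * (1 - ((σ 1 : ℕ) - (σ 2 : ℕ))) := by
  have benchmark : biasedCoin (-ε) ⬝ᵥ
      (fun x => sumLoss (Equiv.swap 1 2) (confusingRelevance x)) = 7 / 2 - ε := by
    have fixed : (Equiv.swap 1 2 : Ranking 3) 0 = 0 := by decide
    rw [biasedCoin_dotProduct_sumLoss, fixed, Equiv.swap_apply_left, Equiv.swap_apply_right]
    norm_num
  rw [dotProduct_excessLoss, benchmark, biasedCoin_dotProduct_sumLoss]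
  ring

theorem isConfusingGame_sumLoss {ε : ℝ} (hε : 0 ≤ ε) (hε' : ε ≤ 1 / 2) :
    IsConfusingGame (excessLoss sumLoss confusingRelevance 1)
      (excessLoss sumLoss confusingRelevance (Equiv.swap 1 2)) (outcomeFeedback confusingRelevance)
      (biasedCoin ε) (biasedCoin (-ε)) (2 * ε) (1 / 2 - ε) := by
  have hgap (σ : Ranking 3) : ((σ 2 : ℕ) : ℝ) - (σ 1 : ℕ) ≤ 1 + (σ 0 : ℕ) ∧
      ((σ 1 : ℕ) : ℝ) - (σ 2 : ℕ) ≤ 1 + (σ 0 : ℕ) := by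
    have := rank_le_rank_add σ
    constructor <;> rw [sub_le_iff_le_add] <;> norm_cast <;> omega
  have hone (σ : Ranking 3) : (σ 0 : ℕ) * (1 / 2 - ε) ≤
      biasedCoin ε ⬝ᵥ excessLoss sumLoss confusingRelevance 1 σ := by
    rw [biasedCoin_dotProduct_excessLoss_one]
    linarith [mul_le_mul_of_nonneg_left (hgap σ).1 hε]
  have hswap (σ : Ranking 3) : (σ 0 : ℕ) * (1 / 2 - ε) ≤
      biasedCoin (-ε) ⬝ᵥ excessLoss sumLoss confusingRelevance (Equiv.swap 1 2) σ := by
    rw [biasedCoin_dotProduct_excessLoss_swap]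
    linarith [mul_le_mul_of_nonneg_left (hgap σ).2 hε]
  have hκ : 0 ≤ 1 / 2 - ε := sub_nonneg.2 hε'
  refine ⟨biasedCoin_mem_stdSimplex (abs_le.2 ⟨by linarith, hε'⟩),
    biasedCoin_mem_stdSimplex (abs_le.2 ⟨by linarith, by linarith⟩),
    fun σ => (hone σ).trans' (by positivity), fun σ => (hswap σ).trans' (by positivity),
    fun σ => ?_⟩
  rcases (σ 0 : ℕ).eq_zero_or_pos with htop | htop
  · refine .inl ⟨⟨1, fun x => ?_⟩, ?_⟩
    · have : σ.symm 0 = 0 := by rw [Equiv.symm_apply_eq]; exact (Fin.ext htop).symm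
      fin_cases x <;> simp [outcomeFeedback, topFeedback, this, confusingRelevance]
    · rw [biasedCoin_dotProduct_excessLoss_one, biasedCoin_dotProduct_excessLoss_swap, htop]
      apply le_of_eq
      push_cast
      ring
  · have hone_le : (1 : ℝ) ≤ (σ 0 : ℕ) := mod_cast htop
    have hκ_le := le_mul_of_one_le_left hκ hone_le
    exact .inr ⟨hκ_le.trans (hone σ), hκ_le.trans (hswap σ)⟩

theorem exists_le_regret_sumLoss {Ω : Type*} [MeasurableSpace Ω] (A : OnlineAlgorithm 3 Ω)
    (μ : Measure Ω) [IsProbabilityMeasure μ] {ε : ℝ} (hε : 0 ≤ ε) {T : ℕ}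
    (hT : 3 * ε + 4 * T * ε ^ 3 ≤ 1) :
    ∃ r : ℕ → Relevance 3, T * ε / 2 ≤ A.regret sumLoss μ r T := by
  have hε' : ε ≤ 1 / 2 := by
    have : 0 ≤ T * ε ^ 3 := by positivity
    linarith
  have hcost : 2 * ε * (1 + T * (1 - bhattacharyya (biasedCoin ε) (biasedCoin (-ε)) ^ 2)) ≤
      4 * (1 / 2 - ε) := by
    rw [bhattacharyya_biasedCoin_neg_sq (by rwa [abs_of_nonneg hε])]
    linarith
  obtain ⟨r, hr⟩ := A.exists_le_regret_of_isConfusingGame (μ := μ)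
    (isConfusingGame_sumLoss hε hε') (by positivity) hcost
  exact ⟨r, by linarith⟩

end TopFeedbackGame

theorem mainTheorem2 :
    ∃ c : ℝ, 0 < c ∧
      ∀ (Ω : Type*) [MeasurableSpace Ω] (μ : Measure Ω) [IsProbabilityMeasure μ]
        (A : OnlineAlgorithm 3 Ω) (T : ℕ), 1 ≤ T →
        ∃ r : ℕ → Relevance 3,
          c * (T : ℝ) ^ (2 / 3 : ℝ) ≤ A.regret sumLoss μ r T ∧
          c * (T : ℝ) ^ (2 / 3 : ℝ) ≤ A.regret pairwiseLoss μ r T := by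
  refine ⟨1 / 8, by norm_num, fun Ω _ μ _ A T hT => ?_⟩
  simp only [← OnlineAlgorithm.regret_sumLoss_eq_regret_pairwiseLoss, and_self]
  have hT : (1 : ℝ) ≤ T := mod_cast hT
  set d : ℝ := (T : ℝ) ^ (-(1 / 3) : ℝ) with hd
  have hd_le_one : d ≤ 1 := Real.rpow_le_one_of_one_le_of_nonpos hT (by norm_num)
  have mul_pow_three : T * d ^ 3 = 1 := by
    have : d ^ 3 = (T : ℝ)⁻¹ := by
      rw [hd, ← Real.rpow_mul_natCast (by positivity), ← Real.rpow_neg_one]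
      norm_num
    rw [this, mul_inv_cancel₀ (by positivity)]
  have rpow_two_thirds : (T : ℝ) ^ (2 / 3 : ℝ) = T * d := by
    rw [hd, ← Real.rpow_one_add' (by positivity) (by norm_num)]
    norm_num
  have hd_div_four : 0 ≤ d / 4 := by rw [hd]; positivity
  obtain ⟨r, hr⟩ := exists_le_regret_sumLoss A μ hd_div_four (T := T) (by linarith)
  exact ⟨r, by linarith⟩
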